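/- Let $d\ge 0$ be an integer, $T>0$ and $\alpha>0$, and let $\mu_u$ and $g_{uv}$ ($1\le u,v\le d$) be real functions on $[0,T]$ (the background rates and triggering kernels of a $d$-dimensional Hawkes process). For $y\in[e^{-\alpha T},1]$ put $\nu_u(y)=\mu_u(-\ln(y)/\alpha)$ and $f_{uv}(y)=g_{uv}(-\ln(y)/\alpha)$. For every $K\ge 1$ there are real coefficients $X^K_{u0,k}$ and $X^K_{uv,k}$ ($0\le k\le K$) such that $\sum_{k=0}^K X^K_{u0,k}\,y^k$ and $\sum_{k=0}^K X^K_{uv,k}\,y^k$ are best uniform approximations on $[e^{-\alpha T},1]$ of $\nu_u$ and $f_{uv}$, respectively, among polynomials of degree at most $K$. For any such coefficients, define the exponential sums $$\widehat\mu^K_u(t)=\sum_{k=0}^K X^K_{u0,k}\,e^{-k\alpha t},\qquad \widehat g^K_{uv}(t)=\sum_{k=0}^K X^K_{uv,k}\,e^{-k\alpha t},\qquad t\in[0,T],$$ and write $\|\Psi\|_{T,\infty}=\sup_{t\in[0,T]}|\Psi(t)|\in[0,\infty]$. Then, for all $u,v$ and every integer $r\ge 0$, as $K$ ranges over $K\ge1$: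 1. if $\mu_u$ is $C^r$ on $[0,T]$, then $\|\mu_u-\widehat\mu^K_u\|_{T,\infty}=O(1/K^r)$; 2. if $\mu_u$ is analytic on $[0,T]$, then $\|\mu_u-\widehat\mu^K_u\|_{T,\infty}$ converges to $0$ at a geometric rate, that is, it is $O(e^{-cK})$ for some $c>0$ independent of $K$; 3. if $g_{uv}$ is $C^r$ on $[0,T]$, then $\|g_{uv}-\widehat g^K_{uv}\|_{T,\infty}=O(1/K^r)$; 4. if $g_{uv}$ is analytic on $[0,T]$, then $\|g_{uv}-\widehat g^K_{uv}\|_{T,\infty}$ converges to $0$ at a geometric rate, that is, it is $O(e^{-cK})$ for some $c>0$ independent of $K$. All constants (including $c$) may depend on the target function, $r$, $\alpha$ and $T$, but not on $K$. -/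

import Mathlib

open Set
open scoped ENNReal

noncomputable section

namespace HawkesApprox

/-- Supremum norm of `Ψ` over `S`, valued in `[0, ∞]` (it is `∞` when `Ψ` is unbounded on `S`). -/
def supNormOn (S : Set ℝ) (Ψ : ℝ → ℝ) : ℝ≥0∞ := ⨆ t ∈ S, ENNReal.ofReal |Ψ t|

/-- The target `φ` read in the variable `y = exp (-α t)`, that is `y ↦ φ (-ln y / α)`. -/
def changeVar (α : ℝ) (φ : ℝ → ℝ) (y : ℝ) : ℝ := φ (-Real.log y / α)

/-- The polynomial `∑_{k ≤ K} c k * y ^ k`. -/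
def polyEval (K : ℕ) (c : ℕ → ℝ) (y : ℝ) : ℝ := ∑ k ∈ Finset.range (K + 1), c k * y ^ k

/-- The exponential sum `∑_{k ≤ K} c k * exp (-k α t)`. -/
def expSum (α : ℝ) (K : ℕ) (c : ℕ → ℝ) (t : ℝ) : ℝ :=
  ∑ k ∈ Finset.range (K + 1), c k * Real.exp (-(k : ℝ) * α * t)

/-- Among all polynomials of degree at most `K`, the one with coefficients `c` is a best uniform
approximation of `ψ` on `S`. -/
def IsBestPolyApprox (S : Set ℝ) (ψ : ℝ → ℝ) (K : ℕ) (c : ℕ → ℝ) : Prop :=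
  ∀ c' : ℕ → ℝ,
    supNormOn S (fun y => ψ y - polyEval K c y) ≤ supNormOn S (fun y => ψ y - polyEval K c' y)

/-- `X K u 0 k` (background rates) and `X K u v.succ k` (triggering kernels) are coefficients of
polynomials of degree at most `K` of best uniform approximation of the transformed background rates
and triggering kernels on `[exp (-α T), 1]`, the image of `[0, T]` under `t ↦ exp (-α t)`. -/
structure IsKApproximation {d : ℕ} (α T : ℝ) (μ : Fin d → ℝ → ℝ) (g : Fin d → Fin d → ℝ → ℝ)
    (X : ℕ → Fin d → Fin (d + 1) → ℕ → ℝ) : Prop where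
  background : ∀ K, 1 ≤ K → ∀ u,
    IsBestPolyApprox (Icc (Real.exp (-α * T)) 1) (changeVar α (μ u)) K (X K u 0)
  kernel : ∀ K, 1 ≤ K → ∀ u v,
    IsBestPolyApprox (Icc (Real.exp (-α * T)) 1) (changeVar α (g u v)) K (X K u v.succ)

/-- The approximated background rate of component `u`. -/
def muHat {d : ℕ} (α : ℝ) (X : ℕ → Fin d → Fin (d + 1) → ℕ → ℝ) (K : ℕ) (u : Fin d) : ℝ → ℝ :=
  expSum α K (X K u 0)

/-- The approximated triggering kernel of the pair `(u, v)`. -/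
def gHat {d : ℕ} (α : ℝ) (X : ℕ → Fin d → Fin (d + 1) → ℕ → ℝ) (K : ℕ) (u v : Fin d) : ℝ → ℝ :=
  expSum α K (X K u v.succ)

/-- `err K = O(1 / K ^ r)` over `K ≥ 1`. -/
def HasPolynomialRate (r : ℕ) (err : ℕ → ℝ≥0∞) : Prop :=
  ∃ C : ℝ, ∀ K : ℕ, 1 ≤ K → err K ≤ ENNReal.ofReal (C * (1 / (K : ℝ) ^ r))

/-- Geometric convergence: `err K = O(exp (-c K))` over `K ≥ 1`, for some constant `c > 0`. -/
def HasGeometricRate (err : ℕ → ℝ≥0∞) : Prop :=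
  ∃ c : ℝ, 0 < c ∧ ∃ C : ℝ, ∀ K : ℕ, 1 ≤ K → err K ≤ ENNReal.ofReal (C * Real.exp (-c * K))

end HawkesApprox

end

/-! The substitution `y = exp (-α t)` turns exponential sums into polynomials on `[exp (-α T), 1]`.
Since that interval stays away from `0`, the logarithm is analytic there and the transformed target
keeps its regularity. A best approximation is at least as good as any competitor, so good
polynomials need only be exhibited.

They come from a quantitative Jackson theorem. Convolution with a kernel of first moment `O(1/m)`
approximates Lipschitz functions (`LipschitzOnWith.exists_polynomial_near`). Applied to `f` minus a
primitive of an approximant of `f'`, this gains a factor `320 (b - a) / (n + 1)` per derivative,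
hence the error `(320 (b - a)) ^ r * B * (n - r)! / n!`. Fixed `r` gives `O(1 / n ^ r)`. For
analytic targets `B = A * M ^ r * r!`, and `r` proportional to `n` gives geometric decay, with no
complex continuation.

Best approximations exist by compactness and lower semicontinuity, even for unbounded targets
(`exists_isBestPolyApprox`). -/

/-! ### An algebraic Jackson kernel. -/

open Polynomial in
/-- The polynomial `q` of degree `2 m` with `q (sin φ) * sin φ = sin ((2 m + 1) φ)`. -/
noncomputable def sinePoly (m : ℕ) : ℝ[X] :=
  1 + 2 * ∑ j ∈ Finset.range m, (Chebyshev.T ℝ ((j + 1 : ℕ) : ℤ)).comp (1 - 2 * X ^ 2)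

namespace sinePoly

theorem natDegree_le (m : ℕ) : (sinePoly m).natDegree ≤ 2 * m := by
  unfold sinePoly
  refine (Polynomial.natDegree_add_le _ _).trans (max_le (by simp) ?_)
  refine Polynomial.natDegree_mul_le.trans ?_
  have h2 : (2 : Polynomial ℝ).natDegree = 0 := Polynomial.natDegree_ofNat 2
  rw [h2, zero_add]
  refine Polynomial.natDegree_sum_le_of_forall_le _ _ fun j hj => ?_
  refine Polynomial.natDegree_comp_le.trans ?_
  have h1 : (Polynomial.Chebyshev.T ℝ ((j + 1 : ℕ) : ℤ)).natDegree = j + 1 := by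
    rw [Polynomial.Chebyshev.natDegree_T]; exact Int.natAbs_natCast _
  have h3 : (1 - 2 * Polynomial.X ^ 2 : Polynomial ℝ).natDegree ≤ 2 := by compute_degree
  rw [h1]
  have := Finset.mem_range.1 hj
  nlinarith

theorem eval_sin (m : ℕ) (φ : ℝ) :
    (sinePoly m).eval (Real.sin φ) =
      1 + 2 * ∑ j ∈ Finset.range m, Real.cos (2 * ((j + 1 : ℕ) * φ)) := by
  have h : 1 - 2 * Real.sin φ ^ 2 = Real.cos (2 * φ) := by
    rw [Real.cos_two_mul, Real.cos_sq']; ring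
  simp only [sinePoly, Polynomial.eval_add, Polynomial.eval_one, Polynomial.eval_mul,
    Polynomial.eval_ofNat, Polynomial.eval_finsetSum, Polynomial.eval_comp, Polynomial.eval_sub,
    Polynomial.eval_pow, Polynomial.eval_X, h, Polynomial.Chebyshev.T_real_cos]
  congr 2
  refine Finset.sum_congr rfl fun j _ => ?_
  congr 1
  push_cast
  ring

theorem eval_sin_mul_sin (m : ℕ) (φ : ℝ) :
    (sinePoly m).eval (Real.sin φ) * Real.sin φ = Real.sin ((2 * m + 1) * φ) := by
  rw [eval_sin]
  induction m with
  | zero => simp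
  | succ m ih =>
    rw [Finset.sum_range_succ, mul_add, ← add_assoc, add_mul, ih]
    have h1 : (2 * ((m + 1 : ℕ) : ℝ) + 1) * φ = 2 * ((m + 1 : ℕ) * φ) + φ := by push_cast; ring
    have h2 : (2 * (m : ℝ) + 1) * φ = 2 * ((m + 1 : ℕ) * φ) - φ := by push_cast; ring
    rw [h1, h2, Real.sin_add, Real.sin_sub]
    ring

theorem abs_eval_mul_le_one (m : ℕ) {t : ℝ} (ht : t ∈ Icc (-1 : ℝ) 1) :
    |(sinePoly m).eval t * t| ≤ 1 := by
  rw [← Real.sin_arcsin ht.1 ht.2, eval_sin_mul_sin]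
  exact Real.abs_sin_le_one _

theorem abs_eval_le (m : ℕ) {t : ℝ} (ht : t ∈ Icc (-1 : ℝ) 1) :
    |(sinePoly m).eval t| ≤ 2 * m + 1 := by
  rw [← Real.sin_arcsin ht.1 ht.2, eval_sin]
  have h : |∑ j ∈ Finset.range m, Real.cos (2 * ((j + 1 : ℕ) * Real.arcsin t))| ≤ m := by
    refine (Finset.abs_sum_le_sum_abs _ _).trans ?_
    refine (Finset.sum_le_sum fun j _ => Real.abs_cos_le_one _).trans ?_
    simp
  rw [abs_le] at h ⊢
  constructor <;> linarith [h.1, h.2]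

theorem abs_sin_nat_mul_le (j : ℕ) (φ : ℝ) : |Real.sin (j * φ)| ≤ j * |Real.sin φ| := by
  induction j with
  | zero => simp
  | succ j ih =>
    push_cast
    rw [add_mul, one_mul, Real.sin_add]
    calc |Real.sin (j * φ) * Real.cos φ + Real.cos (j * φ) * Real.sin φ|
        ≤ |Real.sin (j * φ)| * |Real.cos φ| + |Real.cos (j * φ)| * |Real.sin φ| := by
          rw [← abs_mul, ← abs_mul]; exact abs_add_le _ _
      _ ≤ |Real.sin (j * φ)| * 1 + 1 * |Real.sin φ| := by
          gcongr
          · exact Real.abs_cos_le_one _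
          · exact Real.abs_cos_le_one _
      _ ≤ (j + 1) * |Real.sin φ| := by linarith

/-- With `t = sin φ`, each cosine is `1 - 2 sin² ((j + 1) φ)`, and `|sin ((j + 1) φ)| ≤ m |t| ≤
1/2`, so every summand is at least `1/2`. -/
theorem le_eval {m : ℕ} (hm : 1 ≤ m) {t : ℝ} (ht : |t| ≤ 1 / (2 * m)) :
    (m : ℝ) ≤ (sinePoly m).eval t := by
  have hm' : (1 : ℝ) ≤ m := by exact_mod_cast hm
  have ht1 : |t| ≤ 1 := ht.trans (by rw [div_le_one (by positivity)]; linarith)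
  have hsin := Real.sin_arcsin (abs_le.1 ht1).1 (abs_le.1 ht1).2
  rw [← hsin, eval_sin]
  have hmt : m * |t| ≤ 1 / 2 := by
    calc m * |t| ≤ m * (1 / (2 * m)) := by gcongr
      _ = 1 / 2 := by field_simp
  have h : ∑ j ∈ Finset.range m, (1 / 2 : ℝ) ≤
      ∑ j ∈ Finset.range m, Real.cos (2 * ((j + 1 : ℕ) * Real.arcsin t)) := by
    refine Finset.sum_le_sum fun j hj => ?_
    have hj : ((j + 1 : ℕ) : ℝ) ≤ m := by exact_mod_cast Finset.mem_range.1 hj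
    have h1 := abs_sin_nat_mul_le (j + 1) (Real.arcsin t)
    rw [hsin] at h1
    have h2 : |Real.sin ((j + 1 : ℕ) * Real.arcsin t)| ≤ 1 / 2 :=
      h1.trans ((mul_le_mul_of_nonneg_right hj (abs_nonneg t)).trans hmt)
    have h3 : Real.sin ((j + 1 : ℕ) * Real.arcsin t) ^ 2 ≤ (1 / 2) ^ 2 := by
      rw [← sq_abs]; gcongr
    rw [Real.cos_two_mul, Real.cos_sq']
    linarith
  simp only [Finset.sum_const, Finset.card_range, nsmul_eq_mul] at h
  linarith

/-- Merges `|q| ≤ 2m + 1` and `|q t| ≤ 1` into one majorant whose integral is an arctangent, so that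
`∫ q²` is `O(m)`. -/
theorem sq_eval_le (m : ℕ) {t : ℝ} (ht : t ∈ Icc (-1 : ℝ) 1) :
    (sinePoly m).eval t ^ 2 ≤ 2 * (2 * m + 1) ^ 2 * (1 + ((2 * m + 1) * t) ^ 2)⁻¹ := by
  have h1 := sq_le_sq' (abs_le.1 (abs_eval_le m ht)).1 (abs_le.1 (abs_eval_le m ht)).2
  have h2 := sq_le_sq' (abs_le.1 (abs_eval_mul_le_one m ht)).1
    (abs_le.1 (abs_eval_mul_le_one m ht)).2
  rw [← div_eq_mul_inv, le_div_iff₀ (by positivity)]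
  have h3 : (0 : ℝ) ≤ (2 * m + 1) ^ 2 := by positivity
  nlinarith [mul_le_mul_of_nonneg_left h2 h3]

theorem integral_sq_le (m : ℕ) :
    ∫ t in (-1 : ℝ)..1, (sinePoly m).eval t ^ 2 ≤ 2 * Real.pi * (2 * m + 1) := by
  have hN : (0 : ℝ) < 2 * m + 1 := by positivity
  have hc : Continuous fun t : ℝ => 2 * (2 * (m : ℝ) + 1) ^ 2 * (1 + ((2 * m + 1) * t) ^ 2)⁻¹ := by
    refine continuous_const.mul (Continuous.inv₀ (by fun_prop) fun t => by positivity)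
  have hle : ∫ t in (-1 : ℝ)..1, (sinePoly m).eval t ^ 2 ≤
      ∫ t in (-1 : ℝ)..1, 2 * (2 * (m : ℝ) + 1) ^ 2 * (1 + ((2 * m + 1) * t) ^ 2)⁻¹ :=
    intervalIntegral.integral_mono_on (by norm_num)
      (((sinePoly m).continuous.pow 2).intervalIntegrable _ _) (hc.intervalIntegrable _ _)
      fun t ht => sq_eval_le m ht
  refine hle.trans ?_
  rw [intervalIntegral.integral_const_mul,
    intervalIntegral.integral_comp_mul_left (fun t => (1 + t ^ 2)⁻¹) hN.ne',
    integral_inv_one_add_sq, smul_eq_mul]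
  have h1 := Real.arctan_lt_pi_div_two ((2 * (m : ℝ) + 1) * 1)
  have h2 := Real.neg_pi_div_two_lt_arctan ((2 * (m : ℝ) + 1) * -1)
  calc 2 * (2 * (m : ℝ) + 1) ^ 2 * ((2 * (m : ℝ) + 1)⁻¹ *
        (Real.arctan ((2 * (m : ℝ) + 1) * 1) - Real.arctan ((2 * (m : ℝ) + 1) * -1)))
      = 2 * (2 * (m : ℝ) + 1) *
        (Real.arctan ((2 * (m : ℝ) + 1) * 1) - Real.arctan ((2 * (m : ℝ) + 1) * -1)) := by
        field_simp
    _ ≤ 2 * (2 * (m : ℝ) + 1) * Real.pi := by gcongr; linarith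
    _ = _ := by ring

/-- The peak alone suffices: `q ≥ m` on an interval of length `1 / m`. -/
theorem cube_le_integral {m : ℕ} (hm : 1 ≤ m) :
    (m : ℝ) ^ 3 ≤ ∫ t in (-1 : ℝ)..1, (sinePoly m).eval t ^ 4 := by
  have hm' : (1 : ℝ) ≤ m := by exact_mod_cast hm
  set δ : ℝ := 1 / (2 * m) with hδ
  have hδ0 : 0 < δ := by positivity
  have hδ1 : δ ≤ 1 := by rw [hδ, div_le_one (by positivity)]; linarith
  have hcont : Continuous fun t : ℝ => (sinePoly m).eval t ^ 4 := (sinePoly m).continuous.pow 4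
  calc (m : ℝ) ^ 3 = ∫ t in (-δ)..δ, (m : ℝ) ^ 4 := by
        rw [intervalIntegral.integral_const, smul_eq_mul, hδ]; field_simp; norm_num
    _ ≤ ∫ t in (-δ)..δ, (sinePoly m).eval t ^ 4 := by
        refine intervalIntegral.integral_mono_on (by linarith) (by simp)
          (hcont.intervalIntegrable _ _) fun t ht => ?_
        have := le_eval hm (abs_le.2 ⟨ht.1, ht.2⟩)
        gcongr
    _ ≤ ∫ t in (-1 : ℝ)..1, (sinePoly m).eval t ^ 4 := by
        refine intervalIntegral.integral_mono_interval (by linarith) (by linarith) hδ1 ?_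
          (hcont.intervalIntegrable _ _)
        exact Filter.Eventually.of_forall fun t => by positivity

theorem integral_abs_mul_le {m : ℕ} (hm : 1 ≤ m) :
    ∫ t in (-1 : ℝ)..1, |t| * (sinePoly m).eval t ^ 4 ≤
      10 / m * ∫ t in (-1 : ℝ)..1, (sinePoly m).eval t ^ 4 := by
  have hm' : (1 : ℝ) ≤ m := by exact_mod_cast hm
  have hq := (sinePoly m).continuous
  have h1 : ∫ t in (-1 : ℝ)..1, |t| * (sinePoly m).eval t ^ 4 ≤
      ∫ t in (-1 : ℝ)..1,
        ((1 / (2 * m)) * (sinePoly m).eval t ^ 4 + (m / 2) * (sinePoly m).eval t ^ 2) := by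
    refine intervalIntegral.integral_mono_on (by norm_num)
      (Continuous.intervalIntegrable (by fun_prop) _ _)
      (Continuous.intervalIntegrable (by fun_prop) _ _) fun t ht => ?_
    have h2 := sq_le_sq' (abs_le.1 (abs_eval_mul_le_one m ht)).1
      (abs_le.1 (abs_eval_mul_le_one m ht)).2
    -- AM-GM at scale `1 / m`; the factor `t²` is then absorbed by `(q t)² ≤ 1`, leaving `q²`.
    have h3 : |t| ≤ 1 / (2 * m) + m / 2 * t ^ 2 := by
      rw [← sub_nonneg, ← sq_abs t]
      have : 1 / (2 * m) + m / 2 * |t| ^ 2 - |t| = (1 - m * |t|) ^ 2 / (2 * m) := by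
        field_simp; ring
      rw [this]; positivity
    have h4 : 0 ≤ (sinePoly m).eval t ^ 2 := by positivity
    have h5 : 0 ≤ (sinePoly m).eval t ^ 4 := by positivity
    calc |t| * (sinePoly m).eval t ^ 4
        ≤ (1 / (2 * m) + m / 2 * t ^ 2) * (sinePoly m).eval t ^ 4 := by gcongr
      _ = 1 / (2 * m) * (sinePoly m).eval t ^ 4 +
          m / 2 * (((sinePoly m).eval t * t) ^ 2 * (sinePoly m).eval t ^ 2) := by ring
      _ ≤ 1 / (2 * m) * (sinePoly m).eval t ^ 4 +
          m / 2 * (1 ^ 2 * (sinePoly m).eval t ^ 2) := by gcongr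
      _ = _ := by ring
  rw [intervalIntegral.integral_add (Continuous.intervalIntegrable (by fun_prop) _ _)
    (Continuous.intervalIntegrable (by fun_prop) _ _), intervalIntegral.integral_const_mul,
    intervalIntegral.integral_const_mul] at h1
  have h2 := integral_sq_le m
  have h3 := cube_le_integral hm
  set J := ∫ t in (-1 : ℝ)..1, (sinePoly m).eval t ^ 4
  have hpi := Real.pi_lt_d2
  have hpi0 := Real.pi_pos
  have h4 : m / 2 * ∫ t in (-1 : ℝ)..1, (sinePoly m).eval t ^ 2 ≤ 9.45 * (m : ℝ) ^ 2 := by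
    calc m / 2 * ∫ t in (-1 : ℝ)..1, (sinePoly m).eval t ^ 2
        ≤ m / 2 * (2 * 3.15 * (3 * m)) := by
          gcongr
          refine h2.trans ?_
          gcongr
          linarith
      _ = _ := by ring
  have h5 : 9.45 * (m : ℝ) ^ 2 ≤ 9.45 / m * J := by
    calc 9.45 * (m : ℝ) ^ 2 = 9.45 / m * (m : ℝ) ^ 3 := by field_simp
      _ ≤ _ := by gcongr
  have h6 : 0 ≤ J := le_trans (by positivity) h3
  -- The constant `10` rounds up `1/2 + 9.45`, where `9.45 = 3.15 * 3` comes from `π < 3.15` and `2m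
  -- + 1 ≤ 3m`.
  have h7 : (10 : ℝ) / m * J = 1 / (2 * m) * J + 9.45 / m * J + 0.05 / m * J := by
    field_simp; ring
  have h8 : 0 ≤ 0.05 / m * J := by positivity
  linarith

end sinePoly

/-- A nonnegative polynomial kernel of mass one concentrated at scale `1 / m`. -/
theorem exists_polynomial_kernel {m : ℕ} (hm : 1 ≤ m) :
    ∃ κ : Polynomial ℝ, κ.natDegree ≤ 8 * m ∧ (∀ t, 0 ≤ κ.eval t) ∧
      ∫ t in (-1 : ℝ)..1, κ.eval t = 1 ∧ ∫ t in (-1 : ℝ)..1, |t| * κ.eval t ≤ 10 / m := by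
  have h1 := sinePoly.cube_le_integral hm
  have h2 := sinePoly.integral_abs_mul_le hm
  have hm' : (1 : ℝ) ≤ m := by exact_mod_cast hm
  set J := ∫ t in (-1 : ℝ)..1, (sinePoly m).eval t ^ 4
  have hJ : 0 < J := lt_of_lt_of_le (by positivity) h1
  refine ⟨Polynomial.C J⁻¹ * sinePoly m ^ 4, ?_, fun t => ?_, ?_, ?_⟩
  · refine (Polynomial.natDegree_C_mul_le _ _).trans (Polynomial.natDegree_pow_le.trans ?_)
    have := sinePoly.natDegree_le m
    linarith
  · simp only [Polynomial.eval_mul, Polynomial.eval_C, Polynomial.eval_pow]; positivity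
  · simp only [Polynomial.eval_mul, Polynomial.eval_C, Polynomial.eval_pow]
    rw [intervalIntegral.integral_const_mul, inv_mul_cancel₀ hJ.ne']
  · simp only [Polynomial.eval_mul, Polynomial.eval_C, Polynomial.eval_pow]
    have : ∀ t : ℝ, |t| * (J⁻¹ * (sinePoly m).eval t ^ 4) =
        J⁻¹ * (|t| * (sinePoly m).eval t ^ 4) := fun t => by ring
    simp_rw [this]
    rw [intervalIntegral.integral_const_mul, inv_mul_le_iff₀ hJ]
    linarith

/-! ### Jackson's theorem for Lipschitz functions. -/

/-- The convolution of a continuous function over a bounded interval with a polynomial is a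
polynomial. -/
theorem exists_polynomial_eq_integral_mul_eval_sub {F : ℝ → ℝ} (hF : Continuous F) (a b : ℝ)
    (κ : Polynomial ℝ) :
    ∃ P : Polynomial ℝ, P.natDegree ≤ κ.natDegree ∧
      ∀ x, P.eval x = ∫ s in a..b, F s * κ.eval (s - x) := by
  refine ⟨∑ k ∈ Finset.range (κ.natDegree + 1), ∑ j ∈ Finset.range (k + 1),
    Polynomial.C (κ.coeff k * (k.choose j) * (-1) ^ (k - j) * ∫ s in a..b, F s * s ^ j) *
      Polynomial.X ^ (k - j), ?_, fun x => ?_⟩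
  · refine Polynomial.natDegree_sum_le_of_forall_le _ _ fun k hk => ?_
    refine Polynomial.natDegree_sum_le_of_forall_le _ _ fun j hj => ?_
    refine (Polynomial.natDegree_C_mul_X_pow_le _ _).trans ?_
    have := Finset.mem_range.1 hk
    omega
  · have h : ∀ s, F s * κ.eval (s - x) = ∑ k ∈ Finset.range (κ.natDegree + 1),
        ∑ j ∈ Finset.range (k + 1),
          (κ.coeff k * (k.choose j) * (-1) ^ (k - j) * x ^ (k - j)) * (F s * s ^ j) := by
      intro s
      rw [Polynomial.eval_eq_sum_range, Finset.mul_sum]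
      refine Finset.sum_congr rfl fun k _ => ?_
      rw [sub_eq_add_neg, add_pow, Finset.mul_sum, Finset.mul_sum]
      refine Finset.sum_congr rfl fun j _ => ?_
      rw [neg_pow x]
      ring
    simp_rw [h]
    rw [intervalIntegral.integral_finsetSum fun k _ =>
      Continuous.intervalIntegrable (by fun_prop) _ _, Polynomial.eval_finsetSum]
    refine Finset.sum_congr rfl fun k _ => ?_
    rw [intervalIntegral.integral_finsetSum fun k _ =>
      Continuous.intervalIntegrable (by fun_prop) _ _, Polynomial.eval_finsetSum]
    refine Finset.sum_congr rfl fun j _ => ?_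
    rw [intervalIntegral.integral_const_mul]
    simp only [Polynomial.eval_mul, Polynomial.eval_C, Polynomial.eval_pow, Polynomial.eval_X]
    ring

/-- A Lipschitz function on `[-1/4, 1/4]` extends, up to a constant, to a Lipschitz function on the
line supported in `[-1/2, 1/2]`. -/
theorem exists_lipschitzWith_support_subset {f : ℝ → ℝ} {L : NNReal}
    (hf : LipschitzOnWith L f (Icc (-1 / 4) (1 / 4))) :
    ∃ F : ℝ → ℝ, LipschitzWith L F ∧ Function.support F ⊆ Ioo (-1 / 2) (1 / 2) ∧
      ∀ x ∈ Icc (-1 / 4 : ℝ) (1 / 4), f x = F x + f 0 := by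
  obtain ⟨g, hg, hfg⟩ := hf.extend_real
  set h : ℝ → ℝ := fun x => L * max 0 (1 / 2 - |x|) with hh
  have hhL : LipschitzWith L h := by
    refine LipschitzWith.of_dist_le_mul fun x y => ?_
    rw [Real.dist_eq, Real.dist_eq, hh, ← mul_sub, abs_mul, NNReal.abs_eq]
    refine mul_le_mul_of_nonneg_left ?_ L.coe_nonneg
    refine (abs_max_sub_max_le_max (0 : ℝ) (1 / 2 - |x|) 0 (1 / 2 - |y|)).trans ?_
    simp only [sub_self, abs_zero, sub_sub_sub_cancel_left]
    refine max_le (abs_nonneg _) ?_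
    rw [abs_sub_comm x y]
    exact abs_abs_sub_abs_le _ _
  have hgL : LipschitzWith L fun x => g x - g 0 :=
    LipschitzWith.of_dist_le_mul fun x y => by
      simpa [Real.dist_eq] using hg.dist_le_mul x y
  -- Clamping by the tent `h` of slope `L` forces the support; for `|x| ≤ 1/4` it is inactive, since
  -- `L |x| ≤ L (1/2 - |x|)`.
  refine ⟨fun x => max (-h x) (min (g x - g 0) (h x)), ?_, ?_, ?_⟩
  · simpa using hhL.neg.max (hgL.min hhL)
  · intro x hx
    by_contra hx'
    apply hx
    have h0 : h x = 0 := by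
      have : 1 / 2 ≤ |x| := by
        rw [mem_Ioo, not_and_or, not_lt, not_lt] at hx'
        rcases hx' with hx' | hx'
        · rw [le_abs]; right; linarith
        · rw [le_abs]; left; linarith
      rw [hh]
      simp only [max_eq_left (sub_nonpos.2 this), mul_zero]
    simp [h0]
  · intro x hx
    have hx' : |x| ≤ 1 / 4 := abs_le.2 ⟨by linarith [hx.1], hx.2⟩
    have h0 : (0 : ℝ) ∈ Icc (-1 / 4 : ℝ) (1 / 4) := by constructor <;> norm_num
    have h1 : |g x - g 0| ≤ L * |x| := by
      simpa [Real.dist_eq] using hg.dist_le_mul x 0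
    have h2 : |g x - g 0| ≤ h x := by
      refine h1.trans ?_
      have h3 : |x| ≤ max 0 (1 / 2 - |x|) := le_max_of_le_right (by linarith)
      exact mul_le_mul_of_nonneg_left h3 L.coe_nonneg
    rw [abs_le] at h2
    simp only
    rw [hfg hx, hfg h0, min_eq_left h2.2, max_eq_right h2.1]
    ring

/-- The approximant is the convolution with the kernel. For `|x| ≤ 1/4` the support of `F` shifted
by `-x` stays inside `[-1, 1]`, so the mass and first moment of the kernel there control the error.
-/
theorem exists_polynomial_near_of_support_subset {F : ℝ → ℝ} {L : NNReal}
    (hF : LipschitzWith L F) (hsupp : Function.support F ⊆ Ioo (-1 / 2) (1 / 2))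
    {m : ℕ} (hm : 1 ≤ m) :
    ∃ p : Polynomial ℝ, p.natDegree ≤ 8 * m ∧
      ∀ x ∈ Icc (-1 / 4 : ℝ) (1 / 4), |F x - p.eval x| ≤ 10 * L / m := by
  obtain ⟨κ, hdeg, hpos, hone, hmom⟩ := exists_polynomial_kernel hm
  have hFc := hF.continuous
  have hκc := κ.continuous
  obtain ⟨P, hPdeg, hP⟩ := exists_polynomial_eq_integral_mul_eval_sub hFc (-1 / 2) (1 / 2) κ
  refine ⟨P, hPdeg.trans hdeg, fun x hx => ?_⟩
  have h1 : P.eval x = ∫ t in (-1 : ℝ)..1, F (x + t) * κ.eval t := by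
    have hs : Function.support (fun s => F s * κ.eval (s - x)) ⊆ Ioo (-1 / 2) (1 / 2) :=
      (Function.support_mul_subset_left _ _).trans hsupp
    have h2 := intervalIntegral.integral_comp_add_left (a := -1) (b := 1)
      (fun s => F s * κ.eval (s - x)) x
    simp only [add_sub_cancel_left] at h2
    rw [hP, h2,
      intervalIntegral.integral_eq_integral_of_support_subset (hs.trans Ioo_subset_Ioc_self),
      intervalIntegral.integral_eq_integral_of_support_subset]
    refine hs.trans fun s hs => ⟨?_, ?_⟩
    · linarith [hs.1, hx.2]
    · linarith [hs.2, hx.1]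
  have h2 : F x - P.eval x = ∫ t in (-1 : ℝ)..1, (F x - F (x + t)) * κ.eval t := by
    have : F x = ∫ t in (-1 : ℝ)..1, F x * κ.eval t := by
      rw [intervalIntegral.integral_const_mul, hone, mul_one]
    rw [h1]
    nth_rw 1 [this]
    rw [← intervalIntegral.integral_sub (Continuous.intervalIntegrable (by fun_prop) _ _)
      (Continuous.intervalIntegrable (by fun_prop) _ _)]
    simp_rw [sub_mul]
  rw [h2]
  calc |∫ t in (-1 : ℝ)..1, (F x - F (x + t)) * κ.eval t|
      ≤ ∫ t in (-1 : ℝ)..1, |(F x - F (x + t)) * κ.eval t| :=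
        intervalIntegral.abs_integral_le_integral_abs (by norm_num)
    _ ≤ ∫ t in (-1 : ℝ)..1, L * (|t| * κ.eval t) := by
        refine intervalIntegral.integral_mono_on (by norm_num)
          (Continuous.intervalIntegrable (by fun_prop) _ _)
          (Continuous.intervalIntegrable (by fun_prop) _ _) fun t _ => ?_
        rw [abs_mul, abs_of_nonneg (hpos t), ← mul_assoc]
        refine mul_le_mul_of_nonneg_right ?_ (hpos t)
        simpa [Real.dist_eq] using hF.dist_le_mul x (x + t)
    _ = L * ∫ t in (-1 : ℝ)..1, |t| * κ.eval t := intervalIntegral.integral_const_mul _ _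
    _ ≤ L * (10 / m) := by gcongr
    _ = 10 * L / m := by ring

theorem LipschitzOnWith.exists_polynomial_near_quarter {f : ℝ → ℝ} {L : NNReal}
    (hf : LipschitzOnWith L f (Icc (-1 / 4) (1 / 4))) {n : ℕ} (hn : 1 ≤ n) :
    ∃ p : Polynomial ℝ, p.natDegree ≤ n ∧
      ∀ x ∈ Icc (-1 / 4 : ℝ) (1 / 4), |f x - p.eval x| ≤ 160 * L / n := by
  have hn' : (0 : ℝ) < n := by exact_mod_cast hn
  rcases lt_or_ge n 8 with h8 | h8
  -- For `n < 8` the choice `m = n / 8` is zero and gives no kernel; a constant is good enough.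
  · refine ⟨Polynomial.C (f 0), by simp, fun x hx => ?_⟩
    have h0 : (0 : ℝ) ∈ Icc (-1 / 4 : ℝ) (1 / 4) := by constructor <;> norm_num
    have h1 := hf.dist_le_mul x hx 0 h0
    simp only [Real.dist_eq, sub_zero] at h1
    have h8' : (n : ℝ) ≤ 8 := by exact_mod_cast h8.le
    have hx' : |x| ≤ 1 / 4 := abs_le.2 ⟨by linarith [hx.1], hx.2⟩
    rw [Polynomial.eval_C, le_div_iff₀ hn']
    calc |f x - f 0| * n ≤ (L * (1 / 4)) * 8 := by gcongr; exact h1.trans (by gcongr)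
      _ ≤ 160 * L := by linarith [L.coe_nonneg]
  · obtain ⟨F, hF, hsupp, hfF⟩ := exists_lipschitzWith_support_subset hf
    have hm : 1 ≤ n / 8 := by omega
    obtain ⟨p, hp, hpF⟩ := exists_polynomial_near_of_support_subset hF hsupp hm
    refine ⟨p + Polynomial.C (f 0), ?_, fun x hx => ?_⟩
    · rw [Polynomial.natDegree_add_C]; omega
    · rw [hfF x hx, Polynomial.eval_add, Polynomial.eval_C, add_sub_add_right_eq_sub]
      refine (hpF x hx).trans ?_
      have hm' : (0 : ℝ) < (n / 8 : ℕ) := by exact_mod_cast hm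
      have h16 : (n : ℝ) ≤ 16 * (n / 8 : ℕ) := by exact_mod_cast (by omega : n ≤ 16 * (n / 8))
      rw [div_le_div_iff₀ hm' hn']
      calc 10 * (L : ℝ) * n ≤ 10 * L * (16 * (n / 8 : ℕ)) := by gcongr
        _ = _ := by ring

/-- Jackson's theorem for Lipschitz functions on a compact interval. -/
theorem LipschitzOnWith.exists_polynomial_near {a b : ℝ} (hab : a < b) {f : ℝ → ℝ} {L : NNReal}
    (hf : LipschitzOnWith L f (Icc a b)) {n : ℕ} (hn : 1 ≤ n) :
    ∃ p : Polynomial ℝ, p.natDegree ≤ n ∧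
      ∀ x ∈ Icc a b, |f x - p.eval x| ≤ 320 * (b - a) * L / n := by
  have hl : 0 < b - a := sub_pos.2 hab
  have hmaps : ∀ y ∈ Icc (-1 / 4 : ℝ) (1 / 4), (a + b) / 2 + 2 * (b - a) * y ∈ Icc a b := by
    intro y hy
    constructor <;> nlinarith [hy.1, hy.2]
  -- Rescaling to length `1/2` multiplies the Lipschitz constant by `2 (b - a)`, hence `320 = 2 *
  -- 160`.
  have hg : LipschitzOnWith (L * (2 * (b - a)).toNNReal)
      (fun y => f ((a + b) / 2 + 2 * (b - a) * y)) (Icc (-1 / 4) (1 / 4)) := by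
    refine LipschitzOnWith.of_dist_le_mul fun x hx y hy => ?_
    refine (hf.dist_le_mul _ (hmaps x hx) _ (hmaps y hy)).trans (le_of_eq ?_)
    rw [NNReal.coe_mul, Real.coe_toNNReal _ (by positivity), mul_assoc (L : ℝ), Real.dist_eq,
      Real.dist_eq, add_sub_add_left_eq_sub, ← mul_sub (2 * (b - a)), abs_mul,
      abs_of_pos (by positivity : 0 < 2 * (b - a))]
  obtain ⟨p, hp, hpg⟩ := hg.exists_polynomial_near_quarter hn
  refine ⟨p.comp (Polynomial.C (2 * (b - a))⁻¹ * (Polynomial.X - Polynomial.C ((a + b) / 2))),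
    ?_, fun x hx => ?_⟩
  · refine Polynomial.natDegree_comp_le.trans ?_
    refine (Nat.mul_le_mul hp (Polynomial.natDegree_C_mul_le _ _)).trans ?_
    simp
  · set y := (2 * (b - a))⁻¹ * (x - (a + b) / 2) with hy
    have hxy : (a + b) / 2 + 2 * (b - a) * y = x := by rw [hy]; field_simp; ring
    have hy' : y ∈ Icc (-1 / 4 : ℝ) (1 / 4) := by
      constructor <;> nlinarith [hx.1, hx.2]
    have h := hpg y hy'
    simp only [hxy, NNReal.coe_mul, Real.coe_toNNReal _ (by positivity : 0 ≤ 2 * (b - a))] at h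
    simp only [Polynomial.eval_comp, Polynomial.eval_mul, Polynomial.eval_C, Polynomial.eval_sub,
      Polynomial.eval_X]
    refine h.trans (le_of_eq ?_)
    ring

/-! ### Jackson's theorem for higher derivatives. -/

theorem Polynomial.exists_derivative_eq_natDegree_le (p : Polynomial ℝ) :
    ∃ q : Polynomial ℝ, q.natDegree ≤ p.natDegree + 1 ∧ q.derivative = p := by
  refine ⟨∑ k ∈ Finset.range (p.natDegree + 1), C (p.coeff k / (k + 1)) * X ^ (k + 1), ?_, ?_⟩
  · refine natDegree_sum_le_of_forall_le _ _ fun k hk => ?_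
    refine (natDegree_C_mul_X_pow_le _ _).trans ?_
    have := Finset.mem_range.1 hk
    omega
  · rw [derivative_sum]
    conv_rhs => rw [p.as_sum_range_C_mul_X_pow]
    refine Finset.sum_congr rfl fun k _ => ?_
    rw [derivative_C_mul_X_pow]
    congr 2
    push_cast
    field_simp

/-- An approximation of the derivative yields a better approximation of the function. -/
theorem exists_polynomial_near_of_derivative {a b : ℝ} (hab : a < b) {f f' : ℝ → ℝ}
    (hf : ∀ x ∈ Icc a b, HasDerivWithinAt f (f' x) (Icc a b) x) {n : ℕ} {p : Polynomial ℝ}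
    (hp : p.natDegree ≤ n) {ε : ℝ} (hpf : ∀ x ∈ Icc a b, |f' x - p.eval x| ≤ ε) :
    ∃ q : Polynomial ℝ, q.natDegree ≤ n + 1 ∧
      ∀ x ∈ Icc a b, |f x - q.eval x| ≤ 320 * (b - a) * ε / (n + 1 : ℕ) := by
  have hε : 0 ≤ ε := (abs_nonneg _).trans (hpf a ⟨le_rfl, hab.le⟩)
  obtain ⟨P, hPdeg, hP⟩ := p.exists_derivative_eq_natDegree_le
  have hlip : LipschitzOnWith ε.toNNReal (fun x => f x - P.eval x) (Icc a b) := by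
    refine (convex_Icc a b).lipschitzOnWith_of_nnnorm_hasDerivWithin_le
      (f' := fun x => f' x - p.eval x) (fun x hx => ?_) fun x hx => ?_
    · have := P.hasDerivWithinAt x (Icc a b)
      rw [hP] at this
      exact (hf x hx).sub this
    · rw [← NNReal.coe_le_coe, coe_nnnorm, Real.coe_toNNReal _ hε]
      exact hpf x hx
  obtain ⟨q, hq, hqf⟩ := hlip.exists_polynomial_near hab (Nat.succ_le_succ n.zero_le)
  refine ⟨P + q, (Polynomial.natDegree_add_le _ _).trans (max_le (by omega) hq), fun x hx => ?_⟩
  have := hqf x hx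
  rw [Real.coe_toNNReal _ hε] at this
  rwa [Polynomial.eval_add, ← sub_sub]

open Nat in
/-- Jackson's inequality, with explicit dependence on the order of differentiability. -/
theorem exists_polynomial_near_of_iterated_derivative {a b : ℝ} (hab : a < b) {B : ℝ} (r : ℕ) :
    ∀ F : ℕ → ℝ → ℝ,
      (∀ k < r, ∀ x ∈ Icc a b, HasDerivWithinAt (F k) (F (k + 1) x) (Icc a b) x) →
      (∀ x ∈ Icc a b, |F r x| ≤ B) → ∀ n, r ≤ n →
      ∃ p : Polynomial ℝ, p.natDegree ≤ n ∧
        ∀ x ∈ Icc a b, |F 0 x - p.eval x| ≤ (320 * (b - a)) ^ r * B * (n - r)! / n ! := by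
  induction r with
  | zero =>
    intro F _ hB n _
    refine ⟨0, by simp, fun x hx => ?_⟩
    have : (n ! : ℝ) ≠ 0 := by positivity
    simpa [mul_div_assoc, div_self this] using hB x hx
  | succ r ih =>
    intro F hF hB n hn
    obtain ⟨n, rfl⟩ : ∃ k, n = k + 1 := ⟨n - 1, by omega⟩
    obtain ⟨p, hp, hpF⟩ := ih (fun k => F (k + 1)) (fun k hk => hF (k + 1) (by omega)) hB n
      (by omega)
    obtain ⟨q, hq, hqF⟩ := exists_polynomial_near_of_derivative hab (hF 0 (by omega)) hp hpF
    refine ⟨q, hq, fun x hx => (hqF x hx).trans (le_of_eq ?_)⟩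
    rw [Nat.add_sub_add_right, Nat.factorial_succ, pow_succ]
    push_cast
    field_simp

open Nat in
theorem ContDiffOn.exists_polynomial_near {a b : ℝ} (hab : a < b) {f : ℝ → ℝ} {r : ℕ}
    (hf : ContDiffOn ℝ r f (Icc a b)) {B : ℝ}
    (hB : ∀ x ∈ Icc a b, |iteratedDerivWithin r f (Icc a b) x| ≤ B) {n : ℕ} (hn : r ≤ n) :
    ∃ p : Polynomial ℝ, p.natDegree ≤ n ∧
      ∀ x ∈ Icc a b, |f x - p.eval x| ≤ (320 * (b - a)) ^ r * B * (n - r)! / n ! := by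
  have := exists_polynomial_near_of_iterated_derivative hab r
    (fun k => iteratedDerivWithin k f (Icc a b)) (fun k hk x hx => ?_) hB n hn
  · simpa using this
  · have h1 := (hf.differentiableOn_iteratedDerivWithin (by exact_mod_cast hk)
      (uniqueDiffOn_Icc hab) x hx).hasDerivWithinAt
    rwa [← iteratedDerivWithin_succ] at h1

/-- `n! / (n - r)!` is a product of `r` factors, each at least `n / 2`. -/
theorem factorial_sub_div_le {n r : ℕ} (hr : 2 * r ≤ n) (hn : 1 ≤ n) :
    ((n - r).factorial : ℝ) / n.factorial ≤ (2 / n) ^ r := by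
  have h1 := Nat.pow_sub_le_descFactorial n r
  have h2 := Nat.factorial_mul_descFactorial (n := n) (k := r) (by omega)
  have hn' : (0 : ℝ) < n := by exact_mod_cast hn
  have h3 : ((n : ℝ) / 2) ^ r ≤ n.descFactorial r := by
    refine le_trans ?_ (by exact_mod_cast h1 : ((n + 1 - r : ℕ) : ℝ) ^ r ≤ n.descFactorial r)
    gcongr
    have : (n : ℝ) ≤ 2 * (n + 1 - r : ℕ) := by exact_mod_cast (by omega : n ≤ 2 * (n + 1 - r))
    linarith
  rw [← h2, Nat.cast_mul, div_mul_eq_div_div, div_self (by positivity),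
    ← inv_div (n : ℝ) 2, inv_pow, one_div]
  exact inv_anti₀ (by positivity) h3

/-- Jackson's theorem for functions of class `C ^ r` on a compact interval. -/
theorem ContDiffOn.exists_jackson_rate {a b : ℝ} (hab : a < b) {f : ℝ → ℝ} {r : ℕ}
    (hf : ContDiffOn ℝ r f (Icc a b)) :
    ∃ C : ℝ, ∀ n : ℕ, 1 ≤ n → ∃ p : Polynomial ℝ, p.natDegree ≤ n ∧
      ∀ x ∈ Icc a b, |f x - p.eval x| ≤ C * (1 / (n : ℝ) ^ r) := by
  obtain ⟨B, hB⟩ := isCompact_Icc.exists_bound_of_continuousOn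
    (hf.continuousOn_iteratedDerivWithin le_rfl (uniqueDiffOn_Icc hab))
  obtain ⟨A, hA⟩ := isCompact_Icc.exists_bound_of_continuousOn hf.continuousOn
  have ha : a ∈ Icc a b := ⟨le_rfl, hab.le⟩
  have hB0 : 0 ≤ B := (norm_nonneg _).trans (hB a ha)
  have hA0 : 0 ≤ A := (norm_nonneg _).trans (hA a ha)
  have hl : 0 < b - a := sub_pos.2 hab
  refine ⟨A * (2 * r) ^ r + (320 * (b - a)) ^ r * B * 2 ^ r, fun n hn => ?_⟩
  have hn' : (0 : ℝ) < n := by exact_mod_cast hn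
  rcases le_or_gt (2 * r) n with h | h
  · obtain ⟨p, hp, hpf⟩ := hf.exists_polynomial_near hab hB (by omega : r ≤ n)
    refine ⟨p, hp, fun x hx => (hpf x hx).trans ?_⟩
    calc (320 * (b - a)) ^ r * B * ((n - r).factorial : ℝ) / n.factorial
        ≤ (320 * (b - a)) ^ r * B * (2 / n) ^ r := by
          rw [mul_div_assoc]
          gcongr
          exact factorial_sub_div_le h hn
      _ = (320 * (b - a)) ^ r * B * 2 ^ r * (1 / (n : ℝ) ^ r) := by rw [div_pow]; ring
      _ ≤ _ := by gcongr; exact le_add_of_nonneg_left (by positivity)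
  -- The finitely many `n < 2 r` are absorbed into the constant, as `1 ≤ (2 r) ^ r / n ^ r`.
  · refine ⟨0, by simp, fun x hx => ?_⟩
    have h' : (n : ℝ) ≤ 2 * r := by exact_mod_cast h.le
    rw [Polynomial.eval_zero, sub_zero]
    calc |f x| ≤ A := hA x hx
      _ ≤ A * ((2 * r) ^ r * (1 / (n : ℝ) ^ r)) := by
          refine le_mul_of_one_le_right hA0 ?_
          rw [mul_one_div, one_le_div (by positivity)]
          gcongr
      _ = A * (2 * r) ^ r * (1 / (n : ℝ) ^ r) := by ring
      _ ≤ _ := by gcongr; exact le_add_of_nonneg_right (by positivity)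

/-! ### Analytic functions and geometric rates. -/

/-- Polynomial approximation at a geometric rate under factorial bounds on the derivatives. -/
theorem exists_geometric_rate_of_iteratedDerivWithin_le {a b : ℝ} (hab : a < b) {f : ℝ → ℝ}
    (hf : ∀ r : ℕ, ContDiffOn ℝ r f (Icc a b)) {A M : ℝ} (hM : 0 < M)
    (hB : ∀ (r : ℕ), ∀ x ∈ Icc a b,
      |iteratedDerivWithin r f (Icc a b) x| ≤ A * M ^ r * r.factorial) :
    ∃ c : ℝ, 0 < c ∧ ∃ C : ℝ, ∀ n : ℕ, 1 ≤ n → ∃ p : Polynomial ℝ, p.natDegree ≤ n ∧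
      ∀ x ∈ Icc a b, |f x - p.eval x| ≤ C * Real.exp (-c * n) := by
  have ha : a ∈ Icc a b := ⟨le_rfl, hab.le⟩
  have hA0 : 0 ≤ A := (abs_nonneg _).trans (by simpa using hB 0 a ha)
  have hl : 0 < b - a := sub_pos.2 hab
  set D := 320 * (b - a) * M with hD
  have hD0 : 0 < D := by positivity
  -- With `r = ⌊δ n⌋`, the bound `1/2` ensures `2 r ≤ n`, and the other makes each derivative gain a
  -- factor `exp (-1)`. Rounding costs the factor `exp 1` in the constant.
  set δ : ℝ := min (1 / 2) (Real.exp (-1) / (2 * D)) with hδ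
  have hδ0 : 0 < δ := by positivity
  refine ⟨δ, hδ0, A * Real.exp 1, fun n hn => ?_⟩
  have hn' : (0 : ℝ) < n := by exact_mod_cast hn
  set r := ⌊δ * n⌋₊ with hr
  have hr1 : (r : ℝ) ≤ δ * n := Nat.floor_le (by positivity)
  have hr2 : δ * n < r + 1 := Nat.lt_floor_add_one _
  have h2r : 2 * r ≤ n := by
    have : (2 * r : ℝ) ≤ n := by
      have : δ ≤ 1 / 2 := min_le_left _ _
      nlinarith
    exact_mod_cast this
  obtain ⟨p, hp, hpf⟩ := (hf r).exists_polynomial_near hab (hB r) (by omega : r ≤ n)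
  refine ⟨p, hp, fun x hx => (hpf x hx).trans ?_⟩
  have hfact : (r.factorial : ℝ) ≤ (r : ℝ) ^ r := by exact_mod_cast Nat.factorial_le_pow r
  have hbase : D * (δ * n) * (2 / n) ≤ Real.exp (-1) := by
    have : δ ≤ Real.exp (-1) / (2 * D) := min_le_right _ _
    calc D * (δ * n) * (2 / n) = δ * (2 * D) := by field_simp
      _ ≤ Real.exp (-1) / (2 * D) * (2 * D) := by gcongr
      _ = Real.exp (-1) := by field_simp
  calc (320 * (b - a)) ^ r * (A * M ^ r * r.factorial) * ((n - r).factorial : ℝ) / n.factorial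
      = A * (D ^ r * r.factorial * (((n - r).factorial : ℝ) / n.factorial)) := by
        rw [hD, mul_pow (320 * (b - a)) M]; ring
    _ ≤ A * (D ^ r * (δ * n) ^ r * (2 / n) ^ r) := by
        gcongr
        · exact hfact.trans (by gcongr)
        · exact factorial_sub_div_le h2r hn
    _ = A * (D * (δ * n) * (2 / n)) ^ r := by rw [mul_pow (D * (δ * n)), mul_pow D]
    _ ≤ A * Real.exp (-1) ^ r := by gcongr
    _ = A * Real.exp (-r) := by rw [← Real.exp_nat_mul]; ring_nf
    _ ≤ A * Real.exp (1 + -δ * n) := by gcongr; linarith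
    _ = A * Real.exp 1 * Real.exp (-δ * n) := by rw [Real.exp_add]; ring

/-- Cauchy estimates for real analytic functions, locally uniformly. -/
theorem AnalyticAt.exists_eventually_iteratedDeriv_le {g : ℝ → ℝ} {x₀ : ℝ}
    (hg : AnalyticAt ℝ g x₀) :
    ∃ A M : ℝ, 0 < A ∧ 0 < M ∧ ∀ᶠ x in nhds x₀, ∀ k : ℕ,
      |iteratedDeriv k g x| ≤ A * M ^ k * k.factorial := by
  obtain ⟨p, R, hp⟩ := hg
  obtain ⟨ρ', hρ'0, hρ'R⟩ := ENNReal.lt_iff_exists_nnreal_btwn.1 hp.r_pos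
  -- One `ρ` is for moving the centre, the other for the recentred series; `S k` below bounds its
  -- `k`-th coefficient uniformly in the new centre, and summability of `S k * ρ ^ k` gives `S k =
  -- O(ρ⁻¹ ^ k)`.
  obtain ⟨ρ, hρ0, hρR⟩ : ∃ ρ : NNReal, 0 < ρ ∧ ((ρ : ℝ≥0∞) + ρ) < R := by
    refine ⟨ρ' / 2, half_pos (by exact_mod_cast hρ'0), ?_⟩
    rwa [← ENNReal.coe_add, add_halves]
  have hρrad := hρR.trans_le hp.r_le
  have hρR' : (ρ : ℝ≥0∞) < R := lt_of_le_of_lt le_self_add hρR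
  set S : ℕ → NNReal := fun k =>
    ∑' s : Σ l : ℕ, { s : Finset (Fin (k + l)) // s.card = l }, ‖p (k + s.1)‖₊ * ρ ^ s.1 with hS
  have hsum : Summable fun k => S k * ρ ^ k := by
    simpa only [hS, ← NNReal.tsum_mul_right] using
      (NNReal.summable_sigma.1 (p.changeOriginSeries_summable_aux₁ hρrad)).2
  set A := ∑' k, S k * ρ ^ k
  have hA : ∀ k, S k * ρ ^ k ≤ A := fun k => hsum.le_tsum k fun _ _ => zero_le
  refine ⟨A + 1, (ρ : ℝ)⁻¹, by positivity, by positivity, ?_⟩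
  filter_upwards [Metric.ball_mem_nhds x₀ (NNReal.coe_pos.2 hρ0)] with x hx k
  obtain ⟨y, rfl⟩ : ∃ y, x = x₀ + y := ⟨x - x₀, by ring⟩
  have hy : ‖y‖₊ < ρ := by
    rw [← NNReal.coe_lt_coe, coe_nnnorm]
    simpa [Real.dist_eq] using hx
  have hyR : (‖y‖₊ : ℝ≥0∞) < R := lt_trans (by exact_mod_cast hy) hρR'
  have h1 : ‖p.changeOrigin y k‖₊ ≤ S k := by
    refine (p.nnnorm_changeOrigin_le k (hyR.trans_le hp.r_le)).trans ?_
    refine Summable.tsum_le_tsum (fun s => ?_)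
      (p.changeOriginSeries_summable_aux₂ (hyR.trans_le hp.r_le) k)
      (p.changeOriginSeries_summable_aux₂ (hρR'.trans_le hp.r_le) k)
    gcongr
  have h2 : ‖p.changeOrigin y k‖ ≤ A * (ρ : ℝ)⁻¹ ^ k := by
    have h3 : (‖p.changeOrigin y k‖₊ : ℝ) * ρ ^ k ≤ A := by
      exact_mod_cast (mul_le_mul_left h1 _).trans (hA k)
    rw [inv_pow, ← div_eq_mul_inv, le_div_iff₀ (by positivity)]
    simpa using h3
  have h3 := (hp.changeOrigin hyR).factorial_smul 1 k
  rw [iteratedDeriv_eq_iteratedFDeriv, ← h3, nsmul_eq_mul, abs_mul, Nat.abs_cast, mul_comm]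
  gcongr
  calc |p.changeOrigin y k fun _ => 1| ≤ ‖p.changeOrigin y k‖ * ∏ _i : Fin k, ‖(1 : ℝ)‖ :=
        (p.changeOrigin y k).le_opNorm _
    _ ≤ A * (ρ : ℝ)⁻¹ ^ k := by simpa using h2
    _ ≤ (A + 1) * (ρ : ℝ)⁻¹ ^ k := by gcongr; linarith

/-- Compactness globalises the local Cauchy estimates. Near each point, endpoints included, `f`
agrees on the interval with a function analytic in a full neighbourhood. -/
theorem AnalyticOn.exists_iteratedDerivWithin_le {a b : ℝ} (hab : a < b) {f : ℝ → ℝ}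
    (hf : AnalyticOn ℝ f (Icc a b)) :
    ∃ A M : ℝ, 0 < A ∧ 0 < M ∧ ∀ x ∈ Icc a b, ∀ k : ℕ,
      |iteratedDerivWithin k f (Icc a b) x| ≤ A * M ^ k * k.factorial := by
  refine (isCompact_Icc (a := a) (b := b)).induction_on
    (p := fun s => ∃ A M : ℝ, 0 < A ∧ 0 < M ∧ ∀ x ∈ s, ∀ k : ℕ,
      |iteratedDerivWithin k f (Icc a b) x| ≤ A * M ^ k * k.factorial)
    ⟨1, 1, one_pos, one_pos, by simp⟩ ?_ ?_ ?_
  · rintro s t hst ⟨A, M, hA, hM, h⟩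
    exact ⟨A, M, hA, hM, fun x hx => h x (hst hx)⟩
  · rintro s t ⟨A, M, hA, hM, h⟩ ⟨A', M', hA', hM', h'⟩
    refine ⟨A + A', max M M', by positivity, by positivity, fun x hx k => ?_⟩
    rcases hx with hx | hx
    · refine (h x hx k).trans ?_
      gcongr
      · linarith
      · exact le_max_left _ _
    · refine (h' x hx k).trans ?_
      gcongr
      · linarith
      · exact le_max_right _ _
  · intro x hx
    obtain ⟨g, -, hfg, hg⟩ := (hf x hx).exists_analyticAt
    rw [insert_eq_of_mem hx] at hfg
    obtain ⟨A, M, hA, hM, h⟩ := hg.exists_eventually_iteratedDeriv_le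
    refine ⟨{y | (∀ k : ℕ, |iteratedDeriv k g y| ≤ A * M ^ k * k.factorial) ∧ AnalyticAt ℝ g y} ∩
      Icc a b, Filter.inter_mem (mem_nhdsWithin_of_mem_nhds (h.and hg.eventually_analyticAt))
      self_mem_nhdsWithin, A, M, hA, hM, ?_⟩
    rintro y ⟨⟨hy, hgy⟩, hyI⟩ k
    rw [iteratedDerivWithin_congr hfg hyI,
      iteratedDerivWithin_eq_iteratedDeriv (uniqueDiffOn_Icc hab) hgy.contDiffAt hyI]
    exact hy k

/-- Analytic functions on a compact interval are approximated by polynomials at a geometric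
rate. -/
theorem AnalyticOn.exists_geometric_rate {a b : ℝ} (hab : a < b) {f : ℝ → ℝ}
    (hf : AnalyticOn ℝ f (Icc a b)) :
    ∃ c : ℝ, 0 < c ∧ ∃ C : ℝ, ∀ n : ℕ, 1 ≤ n → ∃ p : Polynomial ℝ, p.natDegree ≤ n ∧
      ∀ x ∈ Icc a b, |f x - p.eval x| ≤ C * Real.exp (-c * n) := by
  obtain ⟨A, M, -, hM, h⟩ := hf.exists_iteratedDerivWithin_le hab
  exact exists_geometric_rate_of_iteratedDerivWithin_le hab
    (fun r => hf.contDiffOn (uniqueDiffOn_Icc hab)) hM fun r x hx => h x hx r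

/-! ### Existence of best uniform approximations. -/

namespace HawkesApprox

theorem le_supNormOn {S : Set ℝ} (Ψ : ℝ → ℝ) {t : ℝ} (ht : t ∈ S) :
    ENNReal.ofReal |Ψ t| ≤ supNormOn S Ψ :=
  le_iSup₂ (f := fun t (_ : t ∈ S) => ENNReal.ofReal |Ψ t|) t ht

theorem supNormOn_le_ofReal {S : Set ℝ} {Ψ : ℝ → ℝ} {ε : ℝ} (h : ∀ t ∈ S, |Ψ t| ≤ ε) :
    supNormOn S Ψ ≤ ENNReal.ofReal ε :=
  iSup₂_le fun t ht => ENNReal.ofReal_le_ofReal (h t ht)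

/-- Extension of a finite coefficient vector by zero. -/
def extendCoeff {K : ℕ} (c : Fin (K + 1) → ℝ) (k : ℕ) : ℝ :=
  if h : k < K + 1 then c ⟨k, h⟩ else 0

theorem polyEval_extendCoeff {K : ℕ} (c : Fin (K + 1) → ℝ) (y : ℝ) :
    polyEval K (extendCoeff c) y = ∑ k : Fin (K + 1), c k * y ^ (k : ℕ) := by
  rw [polyEval, Finset.sum_range]
  exact Finset.sum_congr rfl fun k _ => by rw [extendCoeff, dif_pos k.isLt]

theorem polyEval_extendCoeff_restrict (K : ℕ) (c : ℕ → ℝ) (y : ℝ) :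
    polyEval K (extendCoeff fun k : Fin (K + 1) => c k) y = polyEval K c y := by
  rw [polyEval_extendCoeff, polyEval, Finset.sum_range]

/-- A supremum of functions continuous in `c`, so no regularity of `ψ` enters. -/
theorem lowerSemicontinuous_supNormOn_sub_polyEval (S : Set ℝ) (ψ : ℝ → ℝ) (K : ℕ) :
    LowerSemicontinuous fun c : Fin (K + 1) → ℝ =>
      supNormOn S fun y => ψ y - polyEval K (extendCoeff c) y := by
  refine lowerSemicontinuous_biSup fun y _ => Continuous.lowerSemicontinuous ?_
  simp_rw [polyEval_extendCoeff]
  exact ENNReal.continuous_ofReal.comp (by fun_prop)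

/-- The coefficient vectors with prescribed bounds at `K + 1` distinct nodes form a compact set. -/
theorem isCompact_setOf_abs_sub_polyEval_le {K : ℕ} {y : Fin (K + 1) → ℝ}
    (hy : Function.Injective y) (ψ : ℝ → ℝ) (M : ℝ) :
    IsCompact {c : Fin (K + 1) → ℝ | ∀ i, |ψ (y i) - polyEval K (extendCoeff c) (y i)| ≤ M} := by
  have hinj : Function.Injective (Matrix.vandermonde y).mulVec :=
    Matrix.mulVec_injective_of_det_ne_zero (Matrix.det_vandermonde_ne_zero_iff.2 hy)
  have hemb : Topology.IsClosedEmbedding (Matrix.vandermonde y).mulVecLin :=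
    LinearMap.isClosedEmbedding_of_injective (LinearMap.ker_eq_bot.2 hinj)
  -- Evaluation at the nodes is the injective Vandermonde map, a closed embedding, so the set is the
  -- preimage of a compact box.
  convert hemb.isCompact_preimage
    (isCompact_univ_pi fun i => isCompact_Icc (a := ψ (y i) - M) (b := ψ (y i) + M)) using 1
  ext c
  have h : ∀ i, (Matrix.vandermonde y).mulVec c i = polyEval K (extendCoeff c) (y i) := by
    intro i
    rw [polyEval_extendCoeff, Matrix.mulVec, dotProduct]
    simp_rw [Matrix.vandermonde_apply, mul_comm]
  simp only [mem_ofPred_eq, mem_preimage, mem_pi, mem_univ, true_imp_iff, mem_Icc,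
    Matrix.mulVecLin_apply, h, abs_le]
  refine forall_congr' fun i => ⟨fun h => ⟨?_, ?_⟩, fun h => ⟨?_, ?_⟩⟩ <;> linarith [h.1, h.2]

/-- Best uniform polynomial approximations of an arbitrary function on an infinite set exist. -/
theorem exists_isBestPolyApprox {S : Set ℝ} (hS : S.Infinite) (ψ : ℝ → ℝ) (K : ℕ) :
    ∃ c, IsBestPolyApprox S ψ K c := by
  by_cases htop : ∀ c', supNormOn S (fun y => ψ y - polyEval K c' y) = ⊤
  · exact ⟨0, fun c' => by rw [htop c']; exact le_top⟩
  push Not at htop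
  obtain ⟨c₀, hc₀⟩ := htop
  set G : (Fin (K + 1) → ℝ) → ℝ≥0∞ := fun c =>
    supNormOn S fun y => ψ y - polyEval K (extendCoeff c) y with hG
  have hGr : ∀ c : ℕ → ℝ, G (fun k => c k) = supNormOn S fun y => ψ y - polyEval K c y := by
    intro c
    simp only [hG, polyEval_extendCoeff_restrict]
  set M := supNormOn S (fun y => ψ y - polyEval K c₀ y)
  obtain ⟨y, hyinj, hyS⟩ : ∃ y : Fin (K + 1) → ℝ, Function.Injective y ∧ ∀ i, y i ∈ S := by
    refine ⟨fun i => hS.natEmbedding S i, fun i j hij => ?_, fun i => (hS.natEmbedding S i).2⟩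
    exact Fin.ext ((hS.natEmbedding S).injective (Subtype.ext hij))
  set B := {c : Fin (K + 1) → ℝ | ∀ i, |ψ (y i) - polyEval K (extendCoeff c) (y i)| ≤ M.toReal}
  have hB : ∀ c, G c ≤ M → c ∈ B := fun c hc i => by
    rw [← ENNReal.ofReal_le_iff_le_toReal hc₀]
    exact (le_supNormOn (fun y => ψ y - polyEval K (extendCoeff c) y) (hyS i)).trans hc
  have hB₀ : (fun k : Fin (K + 1) => c₀ k) ∈ B := hB _ (hGr c₀).le
  obtain ⟨c, -, hcmin⟩ := ((lowerSemicontinuous_supNormOn_sub_polyEval S ψ K).lowerSemicontinuousOn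
    B).exists_isMinOn ⟨_, hB₀⟩ (isCompact_setOf_abs_sub_polyEval_le hyinj ψ M.toReal)
  refine ⟨extendCoeff c, fun c' => ?_⟩
  rw [← hGr c']
  -- A competitor either lies in the compact set `B` or does no better than `c₀`, which does.
  rcases le_total (G fun k => c' k) M with h | h
  · exact hcmin (hB _ h)
  · exact (hcmin hB₀).trans ((hGr c₀).le.trans h)

theorem polyEval_coeff {K : ℕ} {p : Polynomial ℝ} (hp : p.natDegree ≤ K) (y : ℝ) :
    polyEval K p.coeff y = p.eval y :=
  (Polynomial.eval_eq_sum_range' (Nat.lt_succ_of_le hp) y).symm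

/-! ### Transfer through the exponential change of variable. -/

variable {α T : ℝ}

theorem exp_neg_mul_lt_one (hα : 0 < α) (hT : 0 < T) : Real.exp (-α * T) < 1 := by
  rw [Real.exp_lt_one_iff]
  nlinarith [mul_pos hα hT]

theorem supNormOn_sub_expSum_le (hα : 0 < α) (φ : ℝ → ℝ) (K : ℕ) (c : ℕ → ℝ) :
    supNormOn (Icc 0 T) (fun t => φ t - expSum α K c t) ≤
      supNormOn (Icc (Real.exp (-α * T)) 1) (fun y => changeVar α φ y - polyEval K c y) := by
  refine iSup₂_le fun t ht => ?_
  have hmem : Real.exp (-α * t) ∈ Icc (Real.exp (-α * T)) 1 := by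
    refine ⟨Real.exp_le_exp.2 ?_, Real.exp_le_one_iff.2 ?_⟩ <;> nlinarith [ht.1, ht.2]
  refine le_trans (le_of_eq ?_) (le_supNormOn _ hmem)
  have h1 : changeVar α φ (Real.exp (-α * t)) = φ t := by
    rw [changeVar, Real.log_exp]
    congr 1
    field_simp
  have h2 : polyEval K c (Real.exp (-α * t)) = expSum α K c t := by
    rw [polyEval, expSum]
    refine Finset.sum_congr rfl fun k _ => ?_
    rw [← Real.exp_nat_mul]
    ring_nf
  simp only [h1, h2]

theorem supNormOn_sub_expSum_le_of_polynomial (hα : 0 < α) {φ : ℝ → ℝ} {K : ℕ} {c : ℕ → ℝ}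
    (hc : IsBestPolyApprox (Icc (Real.exp (-α * T)) 1) (changeVar α φ) K c) {p : Polynomial ℝ}
    (hp : p.natDegree ≤ K) {ε : ℝ}
    (hpε : ∀ y ∈ Icc (Real.exp (-α * T)) 1, |changeVar α φ y - p.eval y| ≤ ε) :
    supNormOn (Icc 0 T) (fun t => φ t - expSum α K c t) ≤ ENNReal.ofReal ε := by
  refine (supNormOn_sub_expSum_le hα φ K c).trans ((hc p.coeff).trans ?_)
  refine supNormOn_le_ofReal fun y hy => ?_
  rw [polyEval_coeff hp]
  exact hpε y hy

theorem mapsTo_neg_log_div (hα : 0 < α) :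
    MapsTo (fun y => -Real.log y / α) (Icc (Real.exp (-α * T)) 1) (Icc 0 T) := by
  intro y hy
  have hy0 : 0 < y := (Real.exp_pos _).trans_le hy.1
  have h1 := (Real.le_log_iff_exp_le hy0).2 hy.1
  have h2 := Real.log_nonpos hy0.le hy.2
  exact ⟨div_nonneg (by linarith) hα.le, by rw [div_le_iff₀ hα]; linarith⟩

theorem analyticOn_neg_log_div (α T : ℝ) :
    AnalyticOn ℝ (fun y => -Real.log y / α) (Icc (Real.exp (-α * T)) 1) := by
  have h : AnalyticOn ℝ Real.log (Icc (Real.exp (-α * T)) 1) :=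
    analyticOn_log.mono fun y hy => (Real.exp_pos _).trans_le hy.1
  simp_rw [div_eq_mul_inv]
  exact h.neg.mul analyticOn_const

theorem hasPolynomialRate (hα : 0 < α) (hT : 0 < T) {φ : ℝ → ℝ} {r : ℕ}
    (hφ : ContDiffOn ℝ r φ (Icc 0 T)) {c : ℕ → ℕ → ℝ}
    (hc : ∀ K, 1 ≤ K → IsBestPolyApprox (Icc (Real.exp (-α * T)) 1) (changeVar α φ) K (c K)) :
    HasPolynomialRate r fun K =>
      supNormOn (Icc 0 T) fun t => φ t - expSum α K (c K) t := by
  have hlt := exp_neg_mul_lt_one hα hT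
  have h : ContDiffOn ℝ r (changeVar α φ) (Icc (Real.exp (-α * T)) 1) :=
    hφ.comp ((analyticOn_neg_log_div α T).contDiffOn (uniqueDiffOn_Icc hlt))
      (mapsTo_neg_log_div hα)
  obtain ⟨C, hC⟩ := h.exists_jackson_rate hlt
  refine ⟨C, fun K hK => ?_⟩
  obtain ⟨p, hp, hpε⟩ := hC K hK
  exact supNormOn_sub_expSum_le_of_polynomial hα (hc K hK) hp hpε

theorem hasGeometricRate (hα : 0 < α) (hT : 0 < T) {φ : ℝ → ℝ}
    (hφ : AnalyticOn ℝ φ (Icc 0 T)) {c : ℕ → ℕ → ℝ}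
    (hc : ∀ K, 1 ≤ K → IsBestPolyApprox (Icc (Real.exp (-α * T)) 1) (changeVar α φ) K (c K)) :
    HasGeometricRate fun K =>
      supNormOn (Icc 0 T) fun t => φ t - expSum α K (c K) t := by
  have hlt := exp_neg_mul_lt_one hα hT
  have h : AnalyticOn ℝ (changeVar α φ) (Icc (Real.exp (-α * T)) 1) :=
    hφ.comp (analyticOn_neg_log_div α T) (mapsTo_neg_log_div hα)
  obtain ⟨γ, hγ, C, hC⟩ := h.exists_geometric_rate hlt
  refine ⟨γ, hγ, C, fun K hK => ?_⟩
  obtain ⟨p, hp, hpε⟩ := hC K hK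
  exact supNormOn_sub_expSum_le_of_polynomial hα (hc K hK) hp hpε

theorem exists_isKApproximation {d : ℕ} (hα : 0 < α) (hT : 0 < T) (μ : Fin d → ℝ → ℝ)
    (g : Fin d → Fin d → ℝ → ℝ) :
    ∃ X : ℕ → Fin d → Fin (d + 1) → ℕ → ℝ, IsKApproximation α T μ g X := by
  have hS := Icc_infinite (exp_neg_mul_lt_one hα hT)
  choose c hc using fun (ψ : ℝ → ℝ) (K : ℕ) => exists_isBestPolyApprox hS ψ K
  refine ⟨fun K u => Fin.cons (c (changeVar α (μ u)) K) fun v => c (changeVar α (g u v)) K,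
    ⟨fun K _ u => ?_, fun K _ u v => ?_⟩⟩
  · rw [Fin.cons_zero]; exact hc _ K
  · rw [Fin.cons_succ]; exact hc _ K

end HawkesApprox

theorem proposition1 {d : ℕ} (α T : ℝ) (hα : 0 < α) (hT : 0 < T)
    (μ : Fin d → ℝ → ℝ) (g : Fin d → Fin d → ℝ → ℝ) :
    (∃ X : ℕ → Fin d → Fin (d + 1) → ℕ → ℝ, HawkesApprox.IsKApproximation α T μ g X) ∧
    ∀ X : ℕ → Fin d → Fin (d + 1) → ℕ → ℝ, HawkesApprox.IsKApproximation α T μ g X →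
      (∀ (u : Fin d) (r : ℕ), ContDiffOn ℝ r (μ u) (Set.Icc 0 T) →
        HawkesApprox.HasPolynomialRate r (fun K =>
          HawkesApprox.supNormOn (Set.Icc 0 T) (fun t => μ u t - HawkesApprox.muHat α X K u t))) ∧
      (∀ u : Fin d, AnalyticOn ℝ (μ u) (Set.Icc 0 T) →
        HawkesApprox.HasGeometricRate (fun K =>
          HawkesApprox.supNormOn (Set.Icc 0 T) (fun t => μ u t - HawkesApprox.muHat α X K u t))) ∧
      (∀ (u v : Fin d) (r : ℕ), ContDiffOn ℝ r (g u v) (Set.Icc 0 T) →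
        HawkesApprox.HasPolynomialRate r (fun K =>
          HawkesApprox.supNormOn (Set.Icc 0 T) (fun t => g u v t - HawkesApprox.gHat α X K u v t))) ∧
      (∀ u v : Fin d, AnalyticOn ℝ (g u v) (Set.Icc 0 T) →
        HawkesApprox.HasGeometricRate (fun K =>
          HawkesApprox.supNormOn (Set.Icc 0 T) (fun t => g u v t - HawkesApprox.gHat α X K u v t))) := by
  refine ⟨HawkesApprox.exists_isKApproximation hα hT μ g, fun X hX => ⟨?_, ?_, ?_, ?_⟩⟩
  · intro u r hμ
    exact HawkesApprox.hasPolynomialRate hα hT hμ fun K hK => hX.background K hK u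
  · intro u hμ
    exact HawkesApprox.hasGeometricRate hα hT hμ fun K hK => hX.background K hK u
  · intro u v r hg
    exact HawkesApprox.hasPolynomialRate hα hT hg fun K hK => hX.kernel K hK u v
  · intro u v hg
    exact HawkesApprox.hasGeometricRate hα hT hg fun K hK => hX.kernel K hK u v
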